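/- Let $N\ge 1$ be a real number, let $(X,\mathrm d)$ be a complete separable metric space, and let $\mathfrak m$ be a Borel measure on $X$ that is finite on bounded sets. Let $\mathscr P_2(X)$ be the set of Borel probability measures $\mu$ on $X$ with $\int_X \mathrm d(x,x_0)^2\,\mathrm d\mu(x)<\infty$ for some $x_0\in X$, with the distance $$W_2(\mu,\nu)=\Big(\inf_\pi\int_{X\times X}\mathrm d(x,y)^2\,\mathrm d\pi(x,y)\Big)^{1/2},$$ where $\pi$ ranges over the probability measures on $X\times X$ with marginals $\mu$ and $\nu$. A geodesic from $\mu_0$ to $\mu_1$ is a curve $(\mu_t)_{t\in[0,1]}$ in $\mathscr P_2(X)$ with these endpoints and $W_2(\mu_s,\mu_t)=|s-t|\,W_2(\mu_0,\mu_1)$ for all $s,t\in[0,1]$. For $\mu\in\mathscr P_2(X)$ with Lebesgue decomposition $\mu=\rho\,\mathfrak m+\mu^s$, $\mu^s\perp\mathfrak m$, and for $N'\ge 1$, the $N'$-Rényi entropy is $\mathcal E_{N'}(\mu)=-\int_{\{\rho>0\}}\rho^{1-1/N'}\,\mathrm d\mathfrak m\in[-\infty,0]$. Assume that $(X,\mathrm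 d,\mathfrak m)$ satisfies the $\mathrm{CD}(0,N)$ condition: for all $\mu_0,\mu_1\in\mathscr P_2(X)$ with bounded support and $\mu_0,\mu_1\ll\mathfrak m$ there is a geodesic $(\mu_t)_{t\in[0,1]}$ in $(\mathscr P_2(X),W_2)$ from $\mu_0$ to $\mu_1$ such that $\mu_t\ll\mathfrak m$ for every $t\in[0,1]$ and such that, for every $N'\ge N$, the function $t\mapsto\mathcal E_{N'}(\mu_t)$ is convex on $[0,1]$. **Theorem (Brunn–Minkowski inequality on $\mathrm{CD}(0,N)$ spaces).** Let $A_0,A_1\subset X$ be Borel sets with $\mathfrak m(A_0)>0$ and $\mathfrak m(A_1)>0$ (possibly infinite), and for $t\in[0,1]$ let $$A_t:=\{y\in X:\ \exists (x_0,x_1)\in A_0\times A_1,\ \mathrm d(x_0,y)=t\,\mathrm d(x_0,x_1),\ \mathrm d(y,x_1)=(1-t)\,\mathrm d(x_0,x_1)\}.$$ Then, for every $t\in[0,1]$ and every $N'\ge N$, the set $A_t$ is $\mathfrak m$-measurable (that is, measurable for the completion of $\mathfrak m$) and $$\mathfrak m(A_t)^{1/N'}\ \ge\ (1-t)\,\mathfrak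 m(A_0)^{1/N'}+t\,\mathfrak m(A_1)^{1/N'},$$ with the conventions $\infty^{1/N'}=\infty$ and $0\cdot\infty=0$. -/

import Mathlib

open MeasureTheory Set
open scoped ENNReal

noncomputable section

namespace CDSpace

/-- `𝒫₂(X)`: the Borel probability measures on `X` with finite second moment. -/
def P2 (X : Type*) [MetricSpace X] [MeasurableSpace X] : Type _ :=
  {μ : ProbabilityMeasure X // ∃ x₀ : X, ∫⁻ x, edist x x₀ ^ 2 ∂(μ : Measure X) < ⊤}

/-- The underlying measure of an element of `𝒫₂(X)`. -/
def P2.toMeasure {X : Type*} [MetricSpace X] [MeasurableSpace X] (μ : P2 X) : Measure X :=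
  (μ.1 : Measure X)

/-- The couplings (transport plans) of `μ` and `ν`: the measures on `X × X` whose first marginal
is `μ` and whose second marginal is `ν`. -/
def couplings {X : Type*} [MeasurableSpace X] (μ ν : Measure X) : Set (Measure (X × X)) :=
  {π | IsProbabilityMeasure π ∧ π.map Prod.fst = μ ∧ π.map Prod.snd = ν}

/-- The quadratic Wasserstein distance; its value is finite on `𝒫₂(X)`. -/
def W2 {X : Type*} [MetricSpace X] [MeasurableSpace X] (μ ν : P2 X) : ℝ≥0∞ :=
  (⨅ π ∈ couplings μ.toMeasure ν.toMeasure, ∫⁻ p, edist p.1 p.2 ^ 2 ∂π) ^ (1 / 2 : ℝ)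

/-- `γ`, restricted to `[0,1]`, is a (minimizing, constant speed) geodesic of `(𝒫₂(X), W₂)`
from `μ₀` to `μ₁`. The values of `γ` outside `[0,1]` play no role. -/
structure IsW2Geodesic {X : Type*} [MetricSpace X] [MeasurableSpace X]
    (γ : ℝ → P2 X) (μ₀ μ₁ : P2 X) : Prop where
  start : γ 0 = μ₀
  finish : γ 1 = μ₁
  speed : ∀ s ∈ Icc (0 : ℝ) 1, ∀ t ∈ Icc (0 : ℝ) 1,
    W2 (γ s) (γ t) = ENNReal.ofReal |s - t| * W2 μ₀ μ₁

/-- The `N`-Rényi entropy `-∫ ρ^(1-1/N) d𝔪`, where `ρ` is the density of the absolutely continuous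
part of `μ` with respect to `𝔪`. The integral is taken over `{ρ ≠ 0}`, so that for `N = 1` the
entropy is `-𝔪 {ρ ≠ 0}` (that is, `0 ^ 0` is read as `0`); for `N > 1` this changes nothing. -/
def renyiEntropy {X : Type*} [MeasurableSpace X] (m : Measure X) (N : ℝ) (μ : Measure X) : EReal :=
  -((∫⁻ x in {x | μ.rnDeriv m x ≠ 0}, μ.rnDeriv m x ^ (1 - 1 / N) ∂m : ℝ≥0∞) : EReal)

/-- Convexity on `[0,1]` of a function with extended real values. It is only applied to functions
with values in `[-∞, 0]`, where the right-hand side is never of the form `∞ - ∞`. -/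
def ConvexOnUnitInterval (f : ℝ → EReal) : Prop :=
  ∀ s ∈ Icc (0 : ℝ) 1, ∀ r ∈ Icc (0 : ℝ) 1, ∀ l ∈ Icc (0 : ℝ) 1,
    f ((1 - l) * s + l * r) ≤ ((1 - l : ℝ) : EReal) * f s + (l : EReal) * f r

/-- The curvature-dimension condition `CD(0,N)` for `(X, d, 𝔪)`. -/
def SatisfiesCD0 {X : Type*} [MetricSpace X] [MeasurableSpace X] (m : Measure X) (N : ℝ) : Prop :=
  ∀ μ₀ μ₁ : P2 X,
    μ₀.toMeasure ≪ m → μ₁.toMeasure ≪ m →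
    Bornology.IsBounded μ₀.toMeasure.support → Bornology.IsBounded μ₁.toMeasure.support →
    ∃ γ : ℝ → P2 X, IsW2Geodesic γ μ₀ μ₁ ∧
      (∀ t ∈ Icc (0 : ℝ) 1, (γ t).toMeasure ≪ m) ∧
      ∀ N' : ℝ, N ≤ N' → ConvexOnUnitInterval fun t => renyiEntropy m N' (γ t).toMeasure

/-- The set of `t`-intermediate points between `A₀` and `A₁`. -/
def intermediatePoints {X : Type*} [MetricSpace X] (A₀ A₁ : Set X) (t : ℝ) : Set X :=
  {y | ∃ x₀ ∈ A₀, ∃ x₁ ∈ A₁, dist x₀ y = t * dist x₀ x₁ ∧ dist y x₁ = (1 - t) * dist x₀ x₁}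

end CDSpace

end

/-! For the uniform probability measure on `K` the Rényi functional `∫ ρ^(1-1/N')` equals
`m(K)^(1/N')`, and by Jensen it is at most `m(B)^(1/N')` for any absolutely continuous probability
measure carried by `B`. Convexity of the entropy along a CD geodesic between uniform measures
therefore gives the inequality as soon as the time-`t` measure is carried by the intermediate
points.

For compact endpoint sets this follows from `d(x₀,y)²/t + d(y,x₁)²/(1-t) ≥ d(x₀,x₁)²`, with equality
only at intermediate points. Gluing almost optimal plans through the time-`t` measure and
integrating shows that the least defect has integral zero; neither optimal plans nor measures on
paths are needed. Inner regularity passes from compact to Borel sets.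

Measurability is separate: `A_t` is a projection of a Borel set, hence analytic, and analytic sets
are universally measurable. -/

namespace CDSpace

open Filter Topology ProbabilityTheory

/-! ### Measurability of the set of intermediate points -/

/-- Choquet capacitability of analytic sets, for finite measures. -/
theorem exists_isCompact_le_measure_of_analyticSet {X : Type*} [TopologicalSpace X]
    [MeasurableSpace X] {μ : Measure X} [μ.OuterRegular]
    {s : Set X} (hs : AnalyticSet s) {c : ℝ≥0∞} (hc : c < μ s) :
    ∃ K ⊆ s, IsCompact K ∧ c ≤ μ K := by
  rw [AnalyticSet] at hs
  rcases hs with rfl | ⟨f, hf, rfl⟩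
  · simp at hc
  -- Bounding one more coordinate keeps the measure of the image above `c`: continuity along
  -- increasing unions needs no measurability of the images.
  have step : ∀ (k : ℕ) (B : {B : Set (ℕ → ℕ) // c < μ (f '' B)}),
      ∃ j : ℕ, c < μ (f '' (B.1 ∩ {x | x k ≤ j})) := by
    rintro k ⟨B, hB⟩
    have hU : f '' B = ⋃ j : ℕ, f '' (B ∩ {x | x k ≤ j}) := by
      rw [← image_iUnion, ← inter_iUnion]
      congr 1
      ext x
      simp only [mem_inter_iff, mem_iUnion, mem_ofPred_eq, iff_self_and]
      exact fun _ => ⟨x k, le_rfl⟩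
    have hmono : Monotone fun j : ℕ => f '' (B ∩ {x | x k ≤ j}) := fun i j hij =>
      image_mono (inter_subset_inter_right _ fun x (hx : x k ≤ i) => hx.trans hij)
    rw [hU, hmono.measure_iUnion] at hB
    exact lt_iSup_iff.1 hB
  choose j hj using step
  let S : ℕ → {B : Set (ℕ → ℕ) // c < μ (f '' B)} := fun k =>
    Nat.rec ⟨univ, by rwa [image_univ]⟩ (fun k B => ⟨B.1 ∩ {x | x k ≤ j k B}, hj k B⟩) k
  have hS : ∀ k, (S (k + 1)).1 = (S k).1 ∩ {x | x k ≤ j k (S k)} := fun k => rfl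
  set n : ℕ → ℕ := fun k => j k (S k) with hn
  have hSn : ∀ k, ∀ x ∈ (S k).1, ∀ i < k, x i ≤ n i := by
    intro k
    induction k with
    | zero => intro x _ i hi; omega
    | succ k ih =>
      intro x hx i hi
      rw [hS] at hx
      rcases Nat.lt_succ_iff_lt_or_eq.1 hi with h | rfl
      · exact ih x hx.1 i h
      · exact hx.2
  have hK : IsCompact (Iic n) := by
    rw [← pi_univ_Iic]
    exact isCompact_univ_pi fun i => (finite_Iic (n i)).isCompact
  refine ⟨f '' Iic n, image_subset_range _ _, hK.image hf, ?_⟩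
  rw [(f '' Iic n).measure_eq_iInf_isOpen μ]
  refine le_iInf₂ fun U hU => le_iInf fun hUo => ?_
  suffices ∃ k, (S k).1 ⊆ f ⁻¹' U by
    obtain ⟨k, hk⟩ := this
    exact (S k).2.le.trans (measure_mono (image_subset_iff.2 hk))
  by_contra! hcon
  simp only [not_subset] at hcon
  choose x hxS hxU using hcon
  -- Points of `S k` obey the bound `n` only in the first `k` coordinates. Truncating by `n` puts
  -- them in the compact box, and each fixed coordinate is eventually unchanged, so the limit is the
  -- same.
  obtain ⟨y, hy, φ, hφ, hlim⟩ := hK.tendsto_subseq (x := fun k => x k ⊓ n) fun k => mem_Iic.2 inf_le_right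
  have hlim' : Tendsto (x ∘ φ) atTop (𝓝 y) := by
    rw [tendsto_pi_nhds] at hlim ⊢
    intro i
    refine (hlim i).congr' ?_
    filter_upwards [hφ.tendsto_atTop.eventually_gt_atTop i] with k hk
    exact inf_eq_left.2 (hSn _ _ (hxS _) i hk)
  have hyU : f ⁻¹' U ∈ 𝓝 y := (hUo.preimage hf).mem_nhds (hU (mem_image_of_mem f hy))
  obtain ⟨k, hk⟩ := (hlim'.eventually hyU).exists
  exact hxU _ hk

/-- Analytic sets are universally measurable. -/
theorem nullMeasurableSet_of_analyticSet {X : Type*} [TopologicalSpace X]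
    [TopologicalSpace.PseudoMetrizableSpace X] [T2Space X] [MeasurableSpace X] [BorelSpace X]
    {μ : Measure X} [SigmaFinite μ] {s : Set X} (hs : AnalyticSet s) : NullMeasurableSet s μ := by
  -- Null measurability depends only on the null sets, so `μ` may be replaced by an equivalent
  -- finite measure.
  refine NullMeasurableSet.mono_ac ?_ (absolutelyContinuous_toFinite μ)
  set ν := μ.toFinite
  rcases eq_or_ne (ν s) 0 with h0 | h0
  · exact NullMeasurableSet.of_null h0
  obtain ⟨c, -, hc, hlim⟩ := exists_seq_strictMono_tendsto' (pos_iff_ne_zero.2 h0)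
  choose K hKs hK hcK using fun k =>
    exists_isCompact_le_measure_of_analyticSet hs (hc k).2
  have hm : NullMeasurableSet (⋃ k, K k) ν :=
    (MeasurableSet.iUnion fun k => (hK k).measurableSet).nullMeasurableSet
  refine hm.congr (ae_eq_of_subset_of_measure_ge (iUnion_subset hKs) ?_ hm (measure_ne_top _ _))
  exact le_of_tendsto' hlim fun k => (hcK k).trans (measure_mono (subset_iUnion K k))

theorem analyticSet_intermediatePoints {X : Type*} [MetricSpace X] [CompleteSpace X]
    [TopologicalSpace.SeparableSpace X] [MeasurableSpace X] [BorelSpace X]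
    {A₀ A₁ : Set X} (hA₀ : MeasurableSet A₀) (hA₁ : MeasurableSet A₁) (t : ℝ) :
    AnalyticSet (intermediatePoints A₀ A₁ t) := by
  have : SecondCountableTopology X := UniformSpace.secondCountable_of_separable X
  have hE : MeasurableSet {p : X × X × X | p.2.1 ∈ A₀ ∧ p.2.2 ∈ A₁ ∧
      dist p.2.1 p.1 = t * dist p.2.1 p.2.2 ∧ dist p.1 p.2.2 = (1 - t) * dist p.2.1 p.2.2} := by
    refine (measurable_snd.fst hA₀).inter ((measurable_snd.snd hA₁).inter
      (IsClosed.measurableSet ?_))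
    exact (isClosed_eq (by fun_prop) (by fun_prop)).inter (isClosed_eq (by fun_prop) (by fun_prop))
  convert hE.analyticSet.image_of_continuous continuous_fst using 1
  ext y
  simp [intermediatePoints]

/-- A measure that is finite on bounded sets is `σ`-finite. -/
theorem sigmaFinite_of_finite_on_bounded {X : Type*} [PseudoMetricSpace X] [MeasurableSpace X]
    {m : Measure X} (hm : ∀ s : Set X, Bornology.IsBounded s → m s < ⊤) : SigmaFinite m := by
  rcases isEmpty_or_nonempty X with h | ⟨⟨x⟩⟩
  · rw [Measure.eq_zero_of_isEmpty m]; infer_instance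
  · refine ⟨⟨⟨fun n : ℕ => Metric.ball x n, fun _ => trivial,
      fun n => hm _ Metric.isBounded_ball, ?_⟩⟩⟩
    exact Metric.iUnion_ball_nat x

/-! ### Gluing of plans and the Wasserstein distance -/

/-- Gluing of two transport plans along their common marginal `ν`; the first coordinate of the
glued measure is the common one. -/
theorem exists_gluing {X : Type*} [MeasurableSpace X] [StandardBorelSpace X] [Nonempty X]
    {μ₀ ν μ₁ : Measure X} {π₁ π₂ : Measure (X × X)}
    (h₁ : π₁ ∈ couplings μ₀ ν) (h₂ : π₂ ∈ couplings ν μ₁) :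
    ∃ σ : Measure (X × X × X), IsProbabilityMeasure σ ∧
      σ.map (fun p => (p.2.1, p.1)) = π₁ ∧ σ.map (fun p => (p.1, p.2.2)) = π₂ := by
  obtain ⟨_, -, hs⟩ := h₁
  obtain ⟨_, hf, -⟩ := h₂
  set π₁' := π₁.map Prod.swap with hπ₁'
  have : IsProbabilityMeasure π₁' :=
    Measure.isProbabilityMeasure_map measurable_swap.aemeasurable
  have hf' : π₁'.fst = ν := by
    rw [Measure.fst, Measure.map_map measurable_fst measurable_swap, ← hs]; rfl
  have hf₂ : π₂.fst = ν := hf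
  have : IsProbabilityMeasure ν := by rw [← hf₂]; infer_instance
  have e₁ : ν ⊗ₘ π₁'.condKernel = π₁' := by rw [← hf']; exact π₁'.disintegrate _
  have e₂ : ν ⊗ₘ π₂.condKernel = π₂ := by rw [← hf₂]; exact π₂.disintegrate _
  -- Given the common point, the two endpoints are drawn independently from the conditional laws of
  -- the plans.
  refine ⟨ν ⊗ₘ (π₁'.condKernel ×ₖ π₂.condKernel), inferInstance, ?_, ?_⟩
  · have : Measure.map (Prod.map id Prod.fst) (ν ⊗ₘ (π₁'.condKernel ×ₖ π₂.condKernel)) = π₁' := by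
      rw [← Measure.compProd_map measurable_fst, ← Kernel.fst_eq, Kernel.fst_prod, e₁]
    have h := congrArg (Measure.map Prod.swap) this
    have hswap : π₁'.map Prod.swap = π₁ := by
      rw [hπ₁', Measure.map_map measurable_swap measurable_swap]; simp
    rw [hswap, Measure.map_map measurable_swap (by fun_prop)] at h
    exact h
  · have : Measure.map (Prod.map id Prod.snd) (ν ⊗ₘ (π₁'.condKernel ×ₖ π₂.condKernel)) = π₂ := by
      rw [← Measure.compProd_map measurable_snd, ← Kernel.snd_eq, Kernel.snd_prod, e₂]
    simpa [Prod.map_def] using this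

/-- The squared Wasserstein distance as an infimum over couplings. -/
theorem W2_sq {X : Type*} [MetricSpace X] [MeasurableSpace X] (μ ν : P2 X) :
    W2 μ ν ^ 2 = ⨅ π ∈ couplings μ.toMeasure ν.toMeasure, ∫⁻ p, edist p.1 p.2 ^ 2 ∂π := by
  rw [W2, ← ENNReal.rpow_natCast, ← ENNReal.rpow_mul]
  norm_num

theorem exists_coupling_lt_W2_sq_add {X : Type*} [MetricSpace X] [MeasurableSpace X] {μ ν : P2 X}
    (h : W2 μ ν ≠ ⊤) {ε : ℝ≥0∞} (hε : ε ≠ 0) :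
    ∃ π ∈ couplings μ.toMeasure ν.toMeasure, ∫⁻ p, edist p.1 p.2 ^ 2 ∂π < W2 μ ν ^ 2 + ε := by
  have : (⨅ π ∈ couplings μ.toMeasure ν.toMeasure, ∫⁻ p, edist p.1 p.2 ^ 2 ∂π)
      < W2 μ ν ^ 2 + ε := by
    rw [← W2_sq]
    exact ENNReal.lt_add_right (ENNReal.pow_ne_top h) hε
  simpa only [iInf_lt_iff, exists_prop] using this

theorem W2_ne_top {X : Type*} [MetricSpace X] [MeasurableSpace X] {μ ν : P2 X} {K : Set X}
    (hK : Bornology.IsBounded K) (hμ : ∀ᵐ x ∂μ.toMeasure, x ∈ K)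
    (hν : ∀ᵐ x ∂ν.toMeasure, x ∈ K) : W2 μ ν ≠ ⊤ := by
  have : IsProbabilityMeasure μ.toMeasure := μ.1.2
  have : IsProbabilityMeasure ν.toMeasure := ν.1.2
  have hπ : μ.toMeasure.prod ν.toMeasure ∈ couplings μ.toMeasure ν.toMeasure :=
    ⟨inferInstance, by simp, by simp⟩
  have h : W2 μ ν ^ 2 ≤ Metric.ediam K ^ 2 := by
    rw [W2_sq]
    refine (iInf₂_le _ hπ).trans ?_
    have hb : ∀ᵐ p ∂(μ.toMeasure.prod ν.toMeasure),
        edist p.1 p.2 ^ 2 ≤ Metric.ediam K ^ 2 := by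
      filter_upwards [Measure.quasiMeasurePreserving_fst.ae hμ,
        Measure.quasiMeasurePreserving_snd.ae hν] with p h₁ h₂
      gcongr
      exact Metric.edist_le_ediam_of_mem h₁ h₂
    exact (lintegral_mono_ae hb).trans (by simp)
  intro htop
  rw [htop] at h
  have := hK.ediam_ne_top
  simp_all

/-! ### The defect and the support of the time-`t` measure -/

/-- The quadratic defect `d(x₀,y)²/t + d(y,x₁)²/(1-t) - d(x₀,x₁)²`, which vanishes precisely when
`y` is a `t`-intermediate point of `x₀` and `x₁`. -/
noncomputable def defect {X : Type*} [MetricSpace X] (t : ℝ) (x₀ y x₁ : X) : ℝ :=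
  dist x₀ y ^ 2 / t + dist y x₁ ^ 2 / (1 - t) - dist x₀ x₁ ^ 2

/-- Completing the square splits the defect into two nonnegative terms: one measures the wrong ratio
of distances, the other the failure of equality in the triangle inequality. -/
theorem defect_eq {X : Type*} [MetricSpace X] {t : ℝ} (h0 : 0 < t) (h1 : t < 1) (x₀ y x₁ : X) :
    defect t x₀ y x₁ = ((1 - t) * dist x₀ y - t * dist y x₁) ^ 2 / (t * (1 - t)) +
      ((dist x₀ y + dist y x₁) ^ 2 - dist x₀ x₁ ^ 2) := by
  have : 1 - t ≠ 0 := by linarith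
  rw [defect]
  field_simp
  ring

theorem defect_nonneg {X : Type*} [MetricSpace X] {t : ℝ} (h0 : 0 < t) (h1 : t < 1)
    (x₀ y x₁ : X) : 0 ≤ defect t x₀ y x₁ := by
  rw [defect_eq h0 h1]
  have h2 : 0 < 1 - t := by linarith
  have := pow_le_pow_left₀ dist_nonneg (dist_triangle x₀ y x₁) 2
  have : 0 ≤ ((1 - t) * dist x₀ y - t * dist y x₁) ^ 2 / (t * (1 - t)) := by positivity
  linarith

theorem dist_eq_of_defect_nonpos {X : Type*} [MetricSpace X] {t : ℝ} (h0 : 0 < t) (h1 : t < 1)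
    {x₀ y x₁ : X} (h : defect t x₀ y x₁ ≤ 0) :
    dist x₀ y = t * dist x₀ x₁ ∧ dist y x₁ = (1 - t) * dist x₀ x₁ := by
  rw [defect_eq h0 h1] at h
  have h2 : 0 < 1 - t := by linarith
  have hle := pow_le_pow_left₀ dist_nonneg (dist_triangle x₀ y x₁) 2
  have hq : 0 ≤ ((1 - t) * dist x₀ y - t * dist y x₁) ^ 2 / (t * (1 - t)) := by positivity
  have e₁ : ((1 - t) * dist x₀ y - t * dist y x₁) ^ 2 / (t * (1 - t)) = 0 := by linarith
  have e₂ : (dist x₀ y + dist y x₁) ^ 2 = dist x₀ x₁ ^ 2 := by linarith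
  have e₃ : (1 - t) * dist x₀ y - t * dist y x₁ = 0 := by
    have : t * (1 - t) ≠ 0 := by positivity
    simpa [this] using e₁
  have e₄ := (pow_left_inj₀ (by positivity) dist_nonneg two_ne_zero).1 e₂
  constructor <;> linarith [congrArg (t * ·) e₄, congrArg ((1 - t) * ·) e₄]

/-- The least defect of `y` with respect to endpoints in `K₀` and `K₁`. -/
noncomputable def minDefect {X : Type*} [MetricSpace X] (t : ℝ) (K₀ K₁ : Set X) (y : X) : ℝ≥0∞ :=
  ⨅ x₀ ∈ K₀, ⨅ x₁ ∈ K₁, ENNReal.ofReal (defect t x₀ y x₁)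

theorem measurable_minDefect {X : Type*} [MetricSpace X] [MeasurableSpace X]
    [OpensMeasurableSpace X] (t : ℝ) (K₀ K₁ : Set X) : Measurable (minDefect t K₀ K₁) := by
  -- An infimum of continuous functions, even uncountable, is upper semicontinuous.
  refine UpperSemicontinuous.measurable (upperSemicontinuous_biInf fun x₀ _ =>
    upperSemicontinuous_biInf fun x₁ _ => Continuous.upperSemicontinuous ?_)
  unfold defect
  exact ENNReal.continuous_ofReal.comp (by fun_prop)

theorem mem_intermediatePoints_of_minDefect_eq_zero {X : Type*} [MetricSpace X] {t : ℝ}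
    (h0 : 0 < t) (h1 : t < 1) {K₀ K₁ : Set X} (hK₀ : IsCompact K₀) (hK₁ : IsCompact K₁) {y : X}
    (h : minDefect t K₀ K₁ y = 0) : y ∈ intermediatePoints K₀ K₁ t := by
  rcases (K₀ ×ˢ K₁).eq_empty_or_nonempty with he | hne
  · rcases prod_eq_empty_iff.1 he with rfl | rfl <;> simp [minDefect] at h
  have hc : ContinuousOn (fun p : X × X => defect t p.1 y p.2) (K₀ ×ˢ K₁) := by
    unfold defect
    exact Continuous.continuousOn (by fun_prop)
  obtain ⟨⟨x₀, x₁⟩, ⟨hx₀, hx₁⟩, hmin⟩ := (hK₀.prod hK₁).exists_isMinOn hne hc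
  have hle : ENNReal.ofReal (defect t x₀ y x₁) ≤ minDefect t K₀ K₁ y :=
    le_iInf₂ fun a ha => le_iInf₂ fun b hb =>
      ENNReal.ofReal_le_ofReal (hmin (show (a, b) ∈ K₀ ×ˢ K₁ from ⟨ha, hb⟩))
  rw [h, nonpos_iff_eq_zero, ENNReal.ofReal_eq_zero] at hle
  exact ⟨x₀, hx₀, x₁, hx₁, dist_eq_of_defect_nonpos h0 h1 hle⟩

theorem minDefect_add_edist_sq_le {X : Type*} [MetricSpace X] {t : ℝ}
    (h0 : 0 < t) (h1 : t < 1) {K₀ K₁ : Set X} {x₀ x₁ : X} (hx₀ : x₀ ∈ K₀) (hx₁ : x₁ ∈ K₁) (y : X) :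
    minDefect t K₀ K₁ y + edist x₀ x₁ ^ 2 ≤
      ENNReal.ofReal t⁻¹ * edist x₀ y ^ 2 + ENNReal.ofReal (1 - t)⁻¹ * edist y x₁ ^ 2 := by
  have h2 : 0 < 1 - t := by linarith
  have hle : minDefect t K₀ K₁ y ≤ ENNReal.ofReal (defect t x₀ y x₁) :=
    (iInf₂_le x₀ hx₀).trans (iInf₂_le x₁ hx₁)
  refine (add_le_add_left hle _).trans_eq ?_
  simp only [edist_dist]
  rw [← ENNReal.ofReal_pow dist_nonneg, ← ENNReal.ofReal_pow dist_nonneg,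
    ← ENNReal.ofReal_pow dist_nonneg, ← ENNReal.ofReal_mul (by positivity),
    ← ENNReal.ofReal_mul (by positivity), ← ENNReal.ofReal_add (defect_nonneg h0 h1 _ _ _) (sq_nonneg _),
    ← ENNReal.ofReal_add (by positivity) (by positivity), defect]
  congr 1
  ring

/-- Integrate the pointwise bound against the glued plan; its projection to the endpoints is a
coupling of `μ₀` and `μ₁`, hence costs at least `W2 μ₀ μ₁ ^ 2`. -/
theorem lintegral_minDefect_add_le {X : Type*} [MetricSpace X] [SecondCountableTopology X]
    [MeasurableSpace X] [BorelSpace X] [StandardBorelSpace X] [Nonempty X] {t : ℝ}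
    (h0 : 0 < t) (h1 : t < 1) {K₀ K₁ : Set X}
    {μ₀ ν μ₁ : P2 X} (hμ₀ : ∀ᵐ x ∂μ₀.toMeasure, x ∈ K₀) (hμ₁ : ∀ᵐ x ∂μ₁.toMeasure, x ∈ K₁)
    {π₁ π₂ : Measure (X × X)} (hπ₁ : π₁ ∈ couplings μ₀.toMeasure ν.toMeasure)
    (hπ₂ : π₂ ∈ couplings ν.toMeasure μ₁.toMeasure) :
    ∫⁻ y, minDefect t K₀ K₁ y ∂ν.toMeasure + W2 μ₀ μ₁ ^ 2 ≤
      ENNReal.ofReal t⁻¹ * ∫⁻ p, edist p.1 p.2 ^ 2 ∂π₁ +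
        ENNReal.ofReal (1 - t)⁻¹ * ∫⁻ p, edist p.1 p.2 ^ 2 ∂π₂ := by
  obtain ⟨σ, hσ, e₁, e₂⟩ := exists_gluing hπ₁ hπ₂
  obtain ⟨_, hf₁, hs₁⟩ := hπ₁
  obtain ⟨_, hf₂, hs₂⟩ := hπ₂
  have m₁ : σ.map (fun p => p.2.1) = μ₀.toMeasure := by
    rw [← hf₁, ← e₁, Measure.map_map (by fun_prop) (by fun_prop)]; rfl
  have m₂ : σ.map (fun p => p.2.2) = μ₁.toMeasure := by
    rw [← hs₂, ← e₂, Measure.map_map (by fun_prop) (by fun_prop)]; rfl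
  have m₃ : σ.map (fun p => p.1) = ν.toMeasure := by
    rw [← hf₂, ← e₂, Measure.map_map (by fun_prop) (by fun_prop)]; rfl
  have hW : W2 μ₀ μ₁ ^ 2 ≤ ∫⁻ p, edist p.2.1 p.2.2 ^ 2 ∂σ := by
    have hc : σ.map (fun p => p.2) ∈ couplings μ₀.toMeasure μ₁.toMeasure := by
      refine ⟨Measure.isProbabilityMeasure_map (by fun_prop), ?_, ?_⟩
      · rw [← m₁, Measure.map_map (by fun_prop) (by fun_prop)]; rfl
      · rw [← m₂, Measure.map_map (by fun_prop) (by fun_prop)]; rfl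
    rw [W2_sq]
    refine (iInf₂_le _ hc).trans_eq ?_
    rw [lintegral_map (by fun_prop) (by fun_prop)]
  have hx₀ : ∀ᵐ p ∂σ, p.2.1 ∈ K₀ := by
    rw [← m₁] at hμ₀
    exact ae_of_ae_map (by fun_prop) hμ₀
  have hx₁ : ∀ᵐ p ∂σ, p.2.2 ∈ K₁ := by
    rw [← m₂] at hμ₁
    exact ae_of_ae_map (by fun_prop) hμ₁
  have hm := measurable_minDefect t K₀ K₁
  rw [← m₃, ← e₁, ← e₂, lintegral_map hm (by fun_prop), lintegral_map (by fun_prop) (by fun_prop),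
    lintegral_map (by fun_prop) (by fun_prop), ← lintegral_const_mul _ (by fun_prop),
    ← lintegral_const_mul _ (by fun_prop), ← lintegral_add_left (by fun_prop)]
  refine (add_le_add_right hW _).trans ?_
  rw [← lintegral_add_left (f := fun p : X × X × X => minDefect t K₀ K₁ p.1)
    (hm.comp measurable_fst)]
  refine lintegral_mono_ae ?_
  filter_upwards [hx₀, hx₁] with p hp₀ hp₁
  exact minDefect_add_edist_sq_le h0 h1 hp₀ hp₁ _

/-- The time-`t` measure of a Wasserstein geodesic between measures carried by compact sets is
carried by the `t`-intermediate points of these sets. -/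
theorem IsW2Geodesic.ae_mem_intermediatePoints {X : Type*} [MetricSpace X]
    [SecondCountableTopology X] [MeasurableSpace X] [BorelSpace X] [StandardBorelSpace X]
    [Nonempty X] {t : ℝ} (h0 : 0 < t) (h1 : t < 1) {K₀ K₁ : Set X}
    (hK₀ : IsCompact K₀) (hK₁ : IsCompact K₁) {μ₀ μ₁ : P2 X}
    (hμ₀ : ∀ᵐ x ∂μ₀.toMeasure, x ∈ K₀) (hμ₁ : ∀ᵐ x ∂μ₁.toMeasure, x ∈ K₁)
    {γ : ℝ → P2 X} (hγ : IsW2Geodesic γ μ₀ μ₁) :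
    ∀ᵐ y ∂(γ t).toMeasure, y ∈ intermediatePoints K₀ K₁ t := by
  have h2 : 0 < 1 - t := by linarith
  have hW : W2 μ₀ μ₁ ≠ ⊤ := W2_ne_top (hK₀.union hK₁).isBounded
    (hμ₀.mono fun x => Or.inl) (hμ₁.mono fun x => Or.inr)
  have w₁ : W2 μ₀ (γ t) = ENNReal.ofReal t * W2 μ₀ μ₁ := by
    have := hγ.speed 0 (by simp) t ⟨h0.le, h1.le⟩
    rwa [hγ.start, zero_sub, abs_neg, abs_of_pos h0] at this
  have w₂ : W2 (γ t) μ₁ = ENNReal.ofReal (1 - t) * W2 μ₀ μ₁ := by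
    have := hγ.speed t ⟨h0.le, h1.le⟩ 1 (by simp)
    rwa [hγ.finish, abs_sub_comm, abs_of_pos h2] at this
  -- Used for `s = t` and `s = 1 - t`: the two weighted costs add up to exactly `W2 μ₀ μ₁ ^ 2`,
  -- which then cancels because it is finite.
  have key : ∀ s : ℝ, 0 < s →
      ENNReal.ofReal s⁻¹ * (ENNReal.ofReal s * W2 μ₀ μ₁) ^ 2 =
        ENNReal.ofReal s * W2 μ₀ μ₁ ^ 2 := fun s hs => by
    rw [mul_pow, ← mul_assoc, ← ENNReal.ofReal_pow hs.le, ← ENNReal.ofReal_mul (by positivity)]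
    congr 2
    field_simp
  set C : ℝ≥0∞ := ENNReal.ofReal t⁻¹ + ENNReal.ofReal (1 - t)⁻¹ with hC
  have hCtop : C ≠ ⊤ := by simp [hC]
  have hbound : ∀ ε : ℝ≥0∞, ε ≠ 0 →
      ∫⁻ y, minDefect t K₀ K₁ y ∂(γ t).toMeasure ≤ C * ε := fun ε hε => by
    obtain ⟨π₁, hπ₁, c₁⟩ := exists_coupling_lt_W2_sq_add (μ := μ₀) (ν := γ t)
      (by rw [w₁]; exact ENNReal.mul_ne_top ENNReal.ofReal_ne_top hW) hε
    obtain ⟨π₂, hπ₂, c₂⟩ := exists_coupling_lt_W2_sq_add (μ := γ t) (ν := μ₁)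
      (by rw [w₂]; exact ENNReal.mul_ne_top ENNReal.ofReal_ne_top hW) hε
    have h := lintegral_minDefect_add_le h0 h1 hμ₀ hμ₁ hπ₁ hπ₂
    rw [← ENNReal.add_le_add_iff_right (ENNReal.pow_ne_top hW : W2 μ₀ μ₁ ^ 2 ≠ ⊤)]
    refine h.trans ((add_le_add (mul_le_mul_right c₁.le _) (mul_le_mul_right c₂.le _)).trans_eq ?_)
    rw [w₁, w₂, mul_add, mul_add, key t h0, key _ h2, add_add_add_comm, ← add_mul, ← add_mul,
      ← ENNReal.ofReal_add h0.le h2.le, add_comm, ← hC]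
    simp
  have hzero : ∫⁻ y, minDefect t K₀ K₁ y ∂(γ t).toMeasure = 0 := by
    refine le_antisymm (ge_of_tendsto (x := 𝓝[>] (0 : ℝ≥0∞)) (f := fun ε => C * ε) ?_ ?_) zero_le
    · have := (ENNReal.continuous_const_mul hCtop).tendsto 0
      rw [mul_zero] at this
      exact this.mono_left nhdsWithin_le_nhds
    · filter_upwards [self_mem_nhdsWithin] with ε hε
      exact hbound ε (ne_of_gt hε)
  rw [lintegral_eq_zero_iff (measurable_minDefect t K₀ K₁)] at hzero
  exact hzero.mono fun y hy => mem_intermediatePoints_of_minDefect_eq_zero h0 h1 hK₀ hK₁ hy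

/-! ### Rényi entropy and volume -/

/-- Jensen's inequality: the Rényi functional of a probability measure is controlled by the volume
of any set carrying the measure. -/
theorem lintegral_rnDeriv_rpow_le {X : Type*} [MeasurableSpace X] {m μ : Measure X}
    [SigmaFinite m] [IsProbabilityMeasure μ] (hμ : μ ≪ m) {N : ℝ} (hN : 1 ≤ N)
    {B : Set X} (hB : ∀ᵐ x ∂μ, x ∈ B) :
    ∫⁻ x in {x | μ.rnDeriv m x ≠ 0}, μ.rnDeriv m x ^ (1 - 1 / N) ∂m ≤ m B ^ (1 / N) := by
  have hN0 : 0 < N := by linarith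
  have hN1 : 1 / N ≤ 1 := by rw [div_le_one hN0]; exact hN
  have hsub : ({x | μ.rnDeriv m x ≠ 0} : Set X) ≤ᵐ[m] B := by
    -- `B` need not be measurable, so the density is tested on a measurable `μ`-null hull of its
    -- complement.
    have hT : ∫⁻ x in toMeasurable μ Bᶜ, μ.rnDeriv m x ∂m = 0 := by
      rw [Measure.setLIntegral_rnDeriv hμ, measure_toMeasurable]; exact hB
    rw [lintegral_eq_zero_iff (Measure.measurable_rnDeriv μ m), EventuallyEq,
      ae_restrict_iff' (measurableSet_toMeasurable _ _)] at hT
    filter_upwards [hT] with x hx hx'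
    by_contra hxB
    exact hx' (hx (subset_toMeasurable _ _ hxB))
  calc ∫⁻ x in {x | μ.rnDeriv m x ≠ 0}, μ.rnDeriv m x ^ (1 - 1 / N) ∂m
      ≤ ∫⁻ x in B, μ.rnDeriv m x ^ (1 - 1 / N) ∂m := lintegral_mono_set' hsub
    _ = ∫⁻ x in B, μ.rnDeriv m x ^ (1 - 1 / N) * (1 : ℝ≥0∞) ^ (1 / N) ∂m := by simp
    _ ≤ (∫⁻ x in B, μ.rnDeriv m x ∂m) ^ (1 - 1 / N) * (∫⁻ _ in B, 1 ∂m) ^ (1 / N) :=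
        ENNReal.lintegral_mul_norm_pow_le (Measure.measurable_rnDeriv μ m).aemeasurable
          aemeasurable_const (by linarith) (by positivity) (by ring)
    _ ≤ 1 ^ (1 - 1 / N) * m B ^ (1 / N) := by
        refine mul_le_mul' (ENNReal.rpow_le_rpow ?_ (by linarith)) (by simp)
        exact (setLIntegral_le_lintegral _ _).trans
          (Measure.lintegral_rnDeriv_le.trans_eq measure_univ)
    _ = m B ^ (1 / N) := by simp

/-- The density is the constant `(m K)⁻¹` on `K`: this is the equality case of Jensen. -/
theorem lintegral_rnDeriv_cond_rpow {X : Type*} [MeasurableSpace X] {m : Measure X}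
    [SigmaFinite m] {K : Set X} (hK : MeasurableSet K) (h0 : m K ≠ 0) (htop : m K ≠ ⊤) (N : ℝ) :
    ∫⁻ x in {x | (m[|K]).rnDeriv m x ≠ 0}, (m[|K]).rnDeriv m x ^ (1 - 1 / N) ∂m
      = m K ^ (1 / N) := by
  have hinv : (m K)⁻¹ ≠ ⊤ := by simpa using h0
  have hρ : (m[|K]).rnDeriv m =ᵐ[m] K.indicator fun _ => (m K)⁻¹ := by
    filter_upwards [Measure.rnDeriv_smul_left_of_ne_top' (m.restrict K) m hinv,
      Measure.rnDeriv_restrict_self m hK] with x h₁ h₂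
    rw [ProbabilityTheory.cond, h₁, Pi.smul_apply, h₂]
    by_cases hx : x ∈ K <;> simp [hx]
  have hset : ({x | (m[|K]).rnDeriv m x ≠ 0} : Set X) =ᵐ[m] K := by
    filter_upwards [hρ] with x hx
    refine propext ⟨fun h => ?_, fun h => ?_⟩
    · by_contra hxK
      exact h (hx.trans (indicator_of_notMem hxK _))
    · change (m[|K]).rnDeriv m x ≠ 0
      rw [hx, indicator_of_mem h]
      simpa using htop
  rw [setLIntegral_congr hset]
  have : ∀ᵐ x ∂m.restrict K, (m[|K]).rnDeriv m x ^ (1 - 1 / N) = (m K)⁻¹ ^ (1 - 1 / N) := by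
    filter_upwards [ae_restrict_of_ae hρ, ae_restrict_mem hK] with x hx hxK
    rw [hx, indicator_of_mem hxK]
  rw [lintegral_congr_ae this, lintegral_const, Measure.restrict_apply_univ, ENNReal.inv_rpow,
    ← ENNReal.rpow_neg]
  nth_rw 2 [← ENNReal.rpow_one (m K)]
  rw [← ENNReal.rpow_add _ _ h0 htop]
  congr 1
  ring

/-- Removes the signs from the convexity inequality. The functional `e` at time `t` may be infinite
a priori; the endpoint values are finite. -/
theorem le_of_neg_le_convexComb {t : ℝ} (h0 : 0 ≤ t) (h1 : t ≤ 1) {a b e : ℝ≥0∞} (ha : a ≠ ⊤)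
    (hb : b ≠ ⊤)
    (h : -(e : EReal) ≤ ((1 - t : ℝ) : EReal) * -(a : EReal) + (t : EReal) * -(b : EReal)) :
    ENNReal.ofReal (1 - t) * a + ENNReal.ofReal t * b ≤ e := by
  rcases eq_or_ne e ⊤ with rfl | he
  · exact le_top
  have h2 : 0 ≤ 1 - t := by linarith
  rw [← EReal.coe_toReal (x := (e : EReal)) (by simpa using he) (by simp),
    ← EReal.coe_toReal (x := (a : EReal)) (by simpa using ha) (by simp),
    ← EReal.coe_toReal (x := (b : EReal)) (by simpa using hb) (by simp)] at h
  simp only [EReal.toReal_coe_ennreal] at h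
  norm_cast at h
  rw [← ENNReal.ofReal_toReal ha, ← ENNReal.ofReal_toReal hb, ← ENNReal.ofReal_toReal he,
    ← ENNReal.ofReal_mul h2, ← ENNReal.ofReal_mul h0,
    ← ENNReal.ofReal_add (by positivity) (by positivity)]
  exact ENNReal.ofReal_le_ofReal (by linarith)

/-! ### The inequality for compact sets and the passage to Borel sets -/

/-- The normalized restriction of `m` to a bounded set, as an element of `𝒫₂(X)`. -/
noncomputable def uniformP2 {X : Type*} [MetricSpace X] [MeasurableSpace X]
    (m : Measure X) {K : Set X} (hb : Bornology.IsBounded K) (hK : MeasurableSet K)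
    (h0 : m K ≠ 0) (htop : m K ≠ ⊤) : P2 X :=
  ⟨⟨m[|K], cond_isProbabilityMeasure_of_finite h0 htop⟩, by
    obtain ⟨x₀, hx₀⟩ := nonempty_of_measure_ne_zero h0
    have : IsProbabilityMeasure m[|K] := cond_isProbabilityMeasure_of_finite h0 htop
    refine ⟨x₀, lt_of_le_of_lt (b := Metric.ediam K ^ 2) ?_
      (ENNReal.pow_lt_top hb.ediam_ne_top.lt_top)⟩
    have hae : ∀ᵐ x ∂m[|K], edist x x₀ ^ 2 ≤ Metric.ediam K ^ 2 := by
      filter_upwards [ae_cond_mem hK] with x hx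
      gcongr
      exact Metric.edist_le_ediam_of_mem hx hx₀
    exact (lintegral_mono_ae hae).trans (by simp)⟩

theorem intermediatePoints_mono {X : Type*} [MetricSpace X] {A₀ A₁ B₀ B₁ : Set X}
    (h₀ : A₀ ⊆ B₀) (h₁ : A₁ ⊆ B₁) (t : ℝ) :
    intermediatePoints A₀ A₁ t ⊆ intermediatePoints B₀ B₁ t := by
  rintro y ⟨x₀, hx₀, x₁, hx₁, h⟩
  exact ⟨x₀, h₀ hx₀, x₁, h₁ hx₁, h⟩

theorem brunnMinkowski_of_isCompact {X : Type*} [MetricSpace X] [CompleteSpace X]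
    [SecondCountableTopology X] [MeasurableSpace X] [BorelSpace X]
    {m : Measure X} (hm : ∀ s : Set X, Bornology.IsBounded s → m s < ⊤)
    {N : ℝ} (hN : 1 ≤ N) (hCD : SatisfiesCD0 m N) {K₀ K₁ : Set X}
    (hK₀ : IsCompact K₀) (hK₁ : IsCompact K₁) (hpos₀ : m K₀ ≠ 0) (hpos₁ : m K₁ ≠ 0)
    {t : ℝ} (h0 : 0 < t) (h1 : t < 1) {N' : ℝ} (hN' : N ≤ N') :
    ENNReal.ofReal (1 - t) * m K₀ ^ (1 / N') + ENNReal.ofReal t * m K₁ ^ (1 / N') ≤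
      m (intermediatePoints K₀ K₁ t) ^ (1 / N') := by
  have : SigmaFinite m := sigmaFinite_of_finite_on_bounded hm
  have hN0 : 0 < N' := by linarith
  have : Nonempty X := (nonempty_of_measure_ne_zero hpos₀).to_type
  have hfin₀ := (hm K₀ hK₀.isBounded).ne
  have hfin₁ := (hm K₁ hK₁.isBounded).ne
  set μ₀ := uniformP2 m hK₀.isBounded hK₀.measurableSet hpos₀ hfin₀
  set μ₁ := uniformP2 m hK₁.isBounded hK₁.measurableSet hpos₁ hfin₁
  have e₀ : μ₀.toMeasure = m[|K₀] := rfl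
  have e₁ : μ₁.toMeasure = m[|K₁] := rfl
  have hae₀ : ∀ᵐ x ∂μ₀.toMeasure, x ∈ K₀ := ae_cond_mem hK₀.measurableSet
  have hae₁ : ∀ᵐ x ∂μ₁.toMeasure, x ∈ K₁ := ae_cond_mem hK₁.measurableSet
  obtain ⟨γ, hγ, hac, hconv⟩ := hCD μ₀ μ₁ cond_absolutelyContinuous cond_absolutelyContinuous
    (hK₀.isBounded.subset (Measure.support_subset_of_isClosed hK₀.isClosed hae₀))
    (hK₁.isBounded.subset (Measure.support_subset_of_isClosed hK₁.isClosed hae₁))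
  have : IsProbabilityMeasure (γ t).toMeasure := (γ t).1.2
  have hc := hconv N' hN' 0 (by simp) 1 (by simp) t ⟨h0.le, h1.le⟩
  simp only [mul_zero, mul_one, zero_add, hγ.start, hγ.finish, renyiEntropy, e₀, e₁,
    lintegral_rnDeriv_cond_rpow hK₀.measurableSet hpos₀ hfin₀,
    lintegral_rnDeriv_cond_rpow hK₁.measurableSet hpos₁ hfin₁] at hc
  exact (le_of_neg_le_convexComb h0.le h1.le
    (ENNReal.rpow_ne_top_of_nonneg (by positivity) hfin₀)
    (ENNReal.rpow_ne_top_of_nonneg (by positivity) hfin₁) hc).trans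
    (lintegral_rnDeriv_rpow_le (hac t ⟨h0.le, h1.le⟩) (hN.trans hN')
      (hγ.ae_mem_intermediatePoints h0 h1 hK₀ hK₁ hae₀ hae₁))

/-- Inner regularity, which also covers `m A = ∞`; taking thresholds strictly above zero keeps every
compact set non-null. -/
theorem exists_seq_isCompact_tendsto_measure {X : Type*} [TopologicalSpace X] [MeasurableSpace X]
    {m : Measure X} [m.InnerRegular] {A : Set X} (hA : MeasurableSet A) (hpos : 0 < m A) :
    ∃ K : ℕ → Set X, (∀ n, K n ⊆ A ∧ IsCompact (K n) ∧ m (K n) ≠ 0) ∧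
      Tendsto (fun n => m (K n)) atTop (𝓝 (m A)) := by
  obtain ⟨c, -, hc, hlim⟩ := exists_seq_strictMono_tendsto' hpos
  choose K hKA hK hcK using fun n => hA.exists_lt_isCompact (hc n).2
  exact ⟨K, fun n => ⟨hKA n, hK n, (zero_le.trans_lt (hcK n)).ne'⟩,
    tendsto_of_tendsto_of_tendsto_of_le_of_le hlim tendsto_const_nhds (fun n => (hcK n).le)
      fun n => measure_mono (hKA n)⟩

theorem intermediatePoints_zero {X : Type*} [MetricSpace X] {A₀ A₁ : Set X}
    (h : A₁.Nonempty) : intermediatePoints A₀ A₁ 0 = A₀ := by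
  obtain ⟨z, hz⟩ := h
  ext y
  refine ⟨?_, fun hy => ⟨y, hy, z, hz, by simp⟩⟩
  rintro ⟨x₀, hx₀, x₁, -, h, -⟩
  rw [zero_mul, dist_eq_zero] at h
  rwa [← h]

theorem intermediatePoints_one {X : Type*} [MetricSpace X] {A₀ A₁ : Set X}
    (h : A₀.Nonempty) : intermediatePoints A₀ A₁ 1 = A₁ := by
  obtain ⟨z, hz⟩ := h
  ext y
  refine ⟨?_, fun hy => ⟨z, hz, y, hy, by simp⟩⟩
  rintro ⟨x₀, -, x₁, hx₁, -, h⟩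
  rw [sub_self, zero_mul, dist_eq_zero] at h
  rwa [h]

end CDSpace

theorem mainTheorem9 {X : Type*} [MetricSpace X] [CompleteSpace X]
    [TopologicalSpace.SeparableSpace X] [MeasurableSpace X] [BorelSpace X]
    (m : Measure X) (hm : ∀ s : Set X, Bornology.IsBounded s → m s < ⊤)
    (N : ℝ) (hN : 1 ≤ N) (hCD : CDSpace.SatisfiesCD0 m N)
    (A₀ A₁ : Set X) (hA₀ : MeasurableSet A₀) (hA₁ : MeasurableSet A₁)
    (hpos₀ : 0 < m A₀) (hpos₁ : 0 < m A₁)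
    (t : ℝ) (ht : t ∈ Icc (0 : ℝ) 1) (N' : ℝ) (hN' : N ≤ N') :
    NullMeasurableSet (CDSpace.intermediatePoints A₀ A₁ t) m ∧
      ENNReal.ofReal (1 - t) * m A₀ ^ (1 / N') + ENNReal.ofReal t * m A₁ ^ (1 / N') ≤
        m (CDSpace.intermediatePoints A₀ A₁ t) ^ (1 / N') := by
  have : SecondCountableTopology X := UniformSpace.secondCountable_of_separable X
  have : SigmaFinite m := CDSpace.sigmaFinite_of_finite_on_bounded hm
  refine ⟨CDSpace.nullMeasurableSet_of_analyticSet
    (CDSpace.analyticSet_intermediatePoints hA₀ hA₁ t), ?_⟩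
  -- The endpoint times are separate because the defect divides by `t` and `1 - t`.
  rcases ht.1.eq_or_lt with rfl | h0
  · simp [CDSpace.intermediatePoints_zero (nonempty_of_measure_ne_zero hpos₁.ne')]
  rcases ht.2.eq_or_lt with rfl | h1
  · simp [CDSpace.intermediatePoints_one (nonempty_of_measure_ne_zero hpos₀.ne')]
  obtain ⟨K₀, hK₀, hlim₀⟩ := CDSpace.exists_seq_isCompact_tendsto_measure hA₀ hpos₀
  obtain ⟨K₁, hK₁, hlim₁⟩ := CDSpace.exists_seq_isCompact_tendsto_measure hA₁ hpos₁
  have hN0 : 0 ≤ 1 / N' := one_div_nonneg.2 (by linarith)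
  refine le_of_tendsto'
    ((ENNReal.Tendsto.const_mul (hlim₀.ennrpow_const _) (.inr ENNReal.ofReal_ne_top)).add
      (ENNReal.Tendsto.const_mul (hlim₁.ennrpow_const _) (.inr ENNReal.ofReal_ne_top)))
    fun n => ?_
  exact (CDSpace.brunnMinkowski_of_isCompact hm hN hCD (hK₀ n).2.1 (hK₁ n).2.1 (hK₀ n).2.2
    (hK₁ n).2.2 h0 h1 hN').trans (ENNReal.rpow_le_rpow
      (measure_mono (CDSpace.intermediatePoints_mono (hK₀ n).1 (hK₁ n).1 t)) hN0)
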